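/- For $n=1,2,\dots$ let $y_n(z)=\sum_{k=0}^{n}\frac{(n+k)!}{(n-k)!\,k!}\left(\frac z2\right)^k$ be the $n$th Bessel polynomial, let $\alpha_{n1},\dots,\alpha_{nn}$ be its complex zeros (listed with multiplicity; they are in fact simple), and put $a_{nk}=1-\alpha_{nk}/2$, $b_{nk}=1+\alpha_{nk}/2$. For a function $f$ analytic in the open unit disk $D=\{|z|<1\}$ let $$r_n(f;z)=zf'(z)-\sum_{k=1}^{n}\bigl(f(a_{nk}z)-f(b_{nk}z)\bigr),$$ and for $x\in(0,1)$ put $n_0(x)=\max\{14,\;x^2(1-x)^{-2}\}-1$. Theorem. Let $f$ be analytic in $D$ and let $\varepsilon\in(0,1)$. Then there is a constant $C(f,\varepsilon)$, depending only on $f$ and $\varepsilon$, such that for every $x\in(0,1)$, every integer $n\ge n_0(x)$ and every complex $z$ with $|z|\le(1-\varepsilon)x$, all the points $a_{nk}z$ and $b_{nk}z$ $(k=1,\dots,n)$ lie in $D$ (so that $r_n(f;z)$ is defined), and $$|r_n(f;z)|\le C(f,\varepsilon)\,\frac{(1-\varepsilon/2)^{2n}\,x^{2n+1}}{(1-x)^{2n+2}}\,\frac{n!^2}{(2n)!^2}.$$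 -/

import Mathlib

open scoped Nat

noncomputable section

/-- The `n`-th Bessel polynomial
`y_n(z) = ∑_{k=0}^n (n+k)! / ((n-k)! k!) (z/2)^k`, over `ℂ`. -/
def besselPoly (n : ℕ) : Polynomial ℂ :=
  ∑ k ∈ Finset.range (n + 1),
    Polynomial.C (((n + k)! : ℂ) / (((n - k)! : ℂ) * (k ! : ℂ)) * (1 / 2) ^ k) *
      Polynomial.X ^ k

/-- The zeros `α_{n1}, …, α_{nn}` of the `n`-th Bessel polynomial, as a multiset
(each zero listed with its multiplicity). -/
def besselZeros (n : ℕ) : Multiset ℂ := (besselPoly n).roots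

/-- The node `a = 1 - α/2` attached to a zero `α`. -/
def nodeA (α : ℂ) : ℂ := 1 - α / 2

/-- The node `b = 1 + α/2` attached to a zero `α`. -/
def nodeB (α : ℂ) : ℂ := 1 + α / 2

/-- The remainder `r_n(f; z) = z f'(z) - ∑_{k=1}^n (f(a_{nk} z) - f(b_{nk} z))` of the
differentiation formula. -/
def remainder (n : ℕ) (f : ℂ → ℂ) (z : ℂ) : ℂ :=
  z * deriv f z - ((besselZeros n).map fun α => f (nodeA α * z) - f (nodeB α * z)).sum

/-- The threshold `n₀(x) = max {14, x² (1-x)⁻²} - 1`. -/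
def nZero (x : ℝ) : ℝ := max 14 (x ^ 2 / (1 - x) ^ 2) - 1

end

open scoped ENNReal

noncomputable section

/-! By Taylor expansion the remainder is `∑ f_m d_m z^m`, where `d_m = m - ∑ (a^m - b^m)`. The
generating series of `d_m` has a closed form (`defectSeries_eq`): with `v = 2(1-X)/X` the node sums
become logarithmic derivatives of `y_n` at `±v`, and `besselPoly_wronskian` collapses them to a
constant times `X^(2n+1) (1-X)^(-2) ∏ 1/((1-aX)(1-bX))`.

This product is estimated in the submultiplicative norm `∑ |F_m| x^m`. Since `(1-aX)(1-bX) = (1-X)^2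
- (α/2)^2 X^2` and `|α/2| ≤ 1/(n+1)`, each factor has norm at most `(1-x)^(-2) (1+1/n)`, and
`(1+1/n)^n ≤ e`. The bound on `α` follows from the differential equation at a zero of largest
modulus. -/

/-! ### Coefficients and degree of the Bessel polynomials. -/

open Polynomial in
theorem besselPoly_coeff (n k : ℕ) : (besselPoly n).coeff k =
    if k ≤ n then ((n + k)! : ℂ) / (((n - k)! : ℂ) * (k ! : ℂ)) * (1 / 2) ^ k else 0 := by
  simp only [besselPoly, finsetSum_coeff, coeff_C_mul_X_pow, Finset.sum_ite_eq,
    Finset.mem_range, Nat.lt_succ_iff]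

/-- This is the differential equation read off coefficientwise; for `k = n` the right factor
vanishes, matching the end of the polynomial. -/
theorem besselPoly_coeff_succ (n k : ℕ) :
    2 * ((k : ℂ) + 1) * (besselPoly n).coeff (k + 1) =
      ((n : ℂ) * (n + 1) - k * (k + 1)) * (besselPoly n).coeff k := by
  simp only [besselPoly_coeff]
  rcases lt_trichotomy k n with h | rfl | h
  · obtain ⟨m, rfl⟩ := Nat.exists_eq_add_of_lt h
    rw [if_pos (by omega), if_pos (by omega)]
    have e1 : k + m + 1 - (k + 1) = m := by omega
    have e2 : k + m + 1 - k = m + 1 := by omega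
    have e3 : k + m + 1 + (k + 1) = (k + m + 1 + k) + 1 := by omega
    rw [e1, e2, e3, Nat.factorial_succ (k + m + 1 + k), Nat.factorial_succ m, Nat.factorial_succ k]
    have h1 : (m ! : ℂ) ≠ 0 := by exact_mod_cast m.factorial_ne_zero
    have h2 : (k ! : ℂ) ≠ 0 := by exact_mod_cast k.factorial_ne_zero
    have h3 : (m : ℂ) + 1 ≠ 0 := by exact_mod_cast m.succ_ne_zero
    have h4 : (k : ℂ) + 1 ≠ 0 := by exact_mod_cast k.succ_ne_zero
    push_cast
    field_simp
    ring
  · simp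
  · rw [if_neg (by omega), if_neg (by omega)]; simp

theorem besselPoly_coeff_zero (n : ℕ) : (besselPoly n).coeff 0 = 1 := by
  have : (n ! : ℂ) ≠ 0 := by exact_mod_cast n.factorial_ne_zero
  simp [besselPoly_coeff, this]

theorem besselPoly_coeff_self (n : ℕ) :
    (besselPoly n).coeff n = ((2 * n)! : ℂ) / (n ! : ℂ) * (1 / 2) ^ n := by
  simp [besselPoly_coeff, two_mul]

theorem besselPoly_coeff_self_ne_zero (n : ℕ) : (besselPoly n).coeff n ≠ 0 := by
  rw [besselPoly_coeff_self]
  have h1 : (n ! : ℂ) ≠ 0 := by exact_mod_cast n.factorial_ne_zero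
  have h2 : ((2 * n)! : ℂ) ≠ 0 := by exact_mod_cast (2 * n).factorial_ne_zero
  exact mul_ne_zero (div_ne_zero h2 h1) (pow_ne_zero _ (by norm_num))

theorem besselPoly_natDegree (n : ℕ) : (besselPoly n).natDegree = n := by
  refine Polynomial.natDegree_eq_of_le_of_coeff_ne_zero ?_ (besselPoly_coeff_self_ne_zero n)
  rw [Polynomial.natDegree_le_iff_coeff_eq_zero]
  intro k hk
  rw [besselPoly_coeff, if_neg (by omega)]

theorem besselPoly_ne_zero (n : ℕ) : besselPoly n ≠ 0 := fun h => by
  simpa [h] using besselPoly_coeff_zero n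

theorem besselPoly_leadingCoeff (n : ℕ) :
    (besselPoly n).leadingCoeff = ((2 * n)! : ℂ) / (n ! : ℂ) * (1 / 2) ^ n := by
  rw [Polynomial.leadingCoeff, besselPoly_natDegree, besselPoly_coeff_self]

theorem card_besselZeros (n : ℕ) : (besselZeros n).card = n := by
  rw [besselZeros, IsAlgClosed.card_roots_eq_natDegree, besselPoly_natDegree]

/-! ### Differential equation and Wronskian identity. -/

open Polynomial in
/-- The differential equation of the Bessel polynomials. -/
theorem besselPoly_ode (n : ℕ) :
    X ^ 2 * derivative (derivative (besselPoly n)) +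
      (C 2 * X + C 2) * derivative (besselPoly n) = C ((n : ℂ) * (n + 1)) * besselPoly n := by
  ext k
  have h := besselPoly_coeff_succ n k
  rw [add_mul, mul_assoc, coeff_add, coeff_add, coeff_C_mul, coeff_C_mul, coeff_C_mul,
    coeff_X_pow_mul']
  rcases k with _ | _ | k
  · simp [coeff_derivative] at h ⊢
    linear_combination h
  · simp [coeff_derivative, coeff_X_mul] at h ⊢
    linear_combination h
  · rw [if_pos (by omega)]
    simp only [coeff_derivative, coeff_X_mul]
    push_cast at h ⊢
    linear_combination h

open Polynomial in
/-- A Wronskian identity linking `y_n(X)` and `y_n(-X)`. -/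
theorem besselPoly_wronskian (n : ℕ) :
    besselPoly n * (besselPoly n).comp (-X) + C (1 / 2) * X ^ 2 *
      (derivative (besselPoly n) * (besselPoly n).comp (-X) +
        besselPoly n * (derivative (besselPoly n)).comp (-X)) = 1 := by
  set y := besselPoly n with hy
  have ode := besselPoly_ode n
  rw [← hy] at ode
  have ode' := congrArg (fun p => p.comp (-X)) ode
  simp only [add_comp, mul_comp, C_comp, X_comp, pow_comp] at ode'
  set M := y * y.comp (-X) + C (1 / 2) * X ^ 2 *
      (derivative y * y.comp (-X) + y * (derivative y).comp (-X)) with hM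
  -- Half of `y(-X)` times the equation at `X`, minus half of `y(X)` times the equation at `-X`,
  -- cancels the right-hand sides and leaves the derivative of `M`.
  have hd : derivative M = 0 := by
    rw [hM]
    simp only [derivative_add, derivative_mul, derivative_comp, derivative_C, derivative_X_pow,
      derivative_neg, derivative_X]
    have hC : (C (1 / 2 : ℂ)) * C 2 = 1 := by rw [← C_mul]; norm_num
    have hC2 : (C ((2 : ℕ) : ℂ)) = C 2 := by norm_num
    rw [hC2]
    simp only [Nat.add_one_sub_one, pow_one]
    linear_combination C (1 / 2) * y.comp (-X) * ode - C (1 / 2) * y * ode' +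
      (- derivative y * y.comp (-X) + y * (derivative y).comp (-X)) * hC
  have h0 := eq_C_of_derivative_eq_zero hd
  rw [h0]
  have : M.coeff 0 = 1 := by
    rw [coeff_zero_eq_eval_zero, hM]
    have : eval 0 y = 1 := by rw [← coeff_zero_eq_eval_zero, hy, besselPoly_coeff_zero]
    simp [this]
  rw [this, C_1]

/-! ### Location of the zeros. -/

theorem half_le_re_inv_one_sub {ζ : ℂ} (h : ‖ζ‖ ≤ 1) (h1 : ζ ≠ 1) :
    1 / 2 ≤ ((1 - ζ)⁻¹).re := by
  have h2 : 0 < Complex.normSq (1 - ζ) := Complex.normSq_pos.2 (sub_ne_zero.2 h1.symm)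
  have h3 : Complex.normSq ζ ≤ 1 := by
    rw [Complex.normSq_eq_norm_sq]; exact pow_le_one₀ (norm_nonneg _) h
  rw [Complex.inv_re, div_le_div_iff₀ two_pos h2]
  simp only [Complex.normSq_apply, Complex.sub_re, Complex.sub_im, Complex.one_re,
    Complex.one_im] at *
  nlinarith

open Polynomial in
/-- Every zero of `y_n` has modulus at most `2 / (n + 1)`. -/
theorem norm_le_of_mem_besselZeros {n : ℕ} {α : ℂ} (hα : α ∈ besselZeros n) :
    ‖α‖ ≤ 2 / (n + 1) := by
  obtain ⟨β, hβ, hmax⟩ := Finset.exists_max_image (besselZeros n).toFinset (fun z => ‖z‖)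
    ⟨α, Multiset.mem_toFinset.2 hα⟩
  refine (hmax α (Multiset.mem_toFinset.2 hα)).trans ?_
  rw [Multiset.mem_toFinset] at hβ
  have hroot : (besselPoly n).IsRoot β := (mem_roots'.1 hβ).2
  obtain ⟨q, hq⟩ := dvd_iff_isRoot.2 hroot
  have hq0 : (X - C β) * q ≠ 0 := hq ▸ besselPoly_ne_zero n
  have hroots : besselZeros n = β ::ₘ q.roots := by
    rw [besselZeros, hq, roots_mul hq0, roots_X_sub_C, Multiset.singleton_add]
  have hcard : q.roots.card + 1 = n := by
    have := card_besselZeros n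
    rwa [hroots, Multiset.card_cons] at this
  have hβ0 : β ≠ 0 := by
    rintro rfl
    have := besselPoly_coeff_zero n
    rw [coeff_zero_eq_eval_zero, hroot.eq_zero] at this
    exact zero_ne_one this
  have hd1 : (derivative (besselPoly n)).eval β = q.eval β := by
    rw [hq]; simp
  have hd2 : (derivative (derivative (besselPoly n))).eval β = 2 * (derivative q).eval β := by
    rw [hq]; simp; ring
  -- The zero `β` is simple: at a double zero the Wronskian identity would read `0 = 1`.
  have hqβ : q.eval β ≠ 0 := by
    intro h
    have := congrArg (eval β) (besselPoly_wronskian n)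
    simp [hroot.eq_zero, hd1, h] at this
  have hode := congrArg (eval β) (besselPoly_ode n)
  simp only [eval_add, eval_mul, eval_pow, eval_X, eval_C, hd1, hd2, hroot.eq_zero] at hode
  have hsum := (IsAlgClosed.splits q).eval_derivative_div_eval_of_ne_zero hqβ
  -- At `β` the equation gives `y''/(2y') = -(β+1)/β²`, and this quotient is `q'/q = ∑ 1/(β - z)`.
  -- By maximality of `|β|` every summand here has real part at least `1/2`.
  have key : (q.roots.map fun z => (1 - z / β)⁻¹).sum = -1 - β⁻¹ := by
    have : (q.roots.map fun z => (1 - z / β)⁻¹) = q.roots.map fun z => β * (1 / (β - z)) := by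
      refine Multiset.map_congr rfl fun z _ => ?_
      rw [one_sub_div hβ0, inv_div, mul_one_div]
    rw [this, Multiset.sum_map_mul_left, ← hsum]
    field_simp
    linear_combination hode / 2
  have hre : (q.roots.card : ℝ) * (1 / 2) ≤ -1 - (β⁻¹).re := by
    have h := congrArg Complex.re key
    rw [← Complex.coe_reAddGroupHom, map_multiset_sum, Multiset.map_map] at h
    have h2 : (q.roots.map fun _ => (1 / 2 : ℝ)).sum ≤
        (q.roots.map (Complex.reAddGroupHom ∘ fun z => (1 - z / β)⁻¹)).sum := by
      refine Multiset.sum_map_le_sum_map _ _ fun z hz => ?_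
      refine half_le_re_inv_one_sub ?_ ?_
      · rw [norm_div, div_le_one (norm_pos_iff.2 hβ0)]
        refine hmax z ?_
        rw [Multiset.mem_toFinset, hroots]
        exact Multiset.mem_cons_of_mem hz
      · rw [Ne, div_eq_one_iff_eq hβ0]
        rintro rfl
        exact hqβ (mem_roots'.1 hz).2
    rw [h] at h2
    simpa using h2
  have hn : (q.roots.card : ℝ) + 1 = n := by exact_mod_cast hcard
  have h1 : ((n : ℝ) + 1) / 2 ≤ ‖β‖⁻¹ := by
    rw [← norm_inv]
    have := (neg_le_abs _).trans (Complex.abs_re_le_norm β⁻¹)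
    linarith
  have := inv_anti₀ (by positivity) h1
  rwa [inv_inv, inv_div] at this

/-! ### Generating series of the defects. -/

/-- The power series `∑ (a X)^m`. -/
def geomSeries (a : ℂ) : PowerSeries ℂ := PowerSeries.mk fun m => a ^ m

theorem geomSeries_mul (a : ℂ) :
    geomSeries a * (1 - PowerSeries.C a * PowerSeries.X) = 1 := by
  ext m
  rw [mul_sub, mul_one, mul_left_comm, map_sub, PowerSeries.coeff_C_mul]
  rcases m with _ | m
  · simp [geomSeries]
  · rw [PowerSeries.coeff_succ_mul_X]
    simp [geomSeries, PowerSeries.coeff_one, pow_succ']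

theorem geomSeries_one_mul : geomSeries 1 * (1 - PowerSeries.X) = 1 := by
  simpa using geomSeries_mul 1

theorem mk_natCast_eq : (PowerSeries.mk fun m => (m : ℂ)) =
    PowerSeries.X * geomSeries 1 ^ 2 := by
  ext m
  rcases m with _ | m
  · simp
  · rw [PowerSeries.coeff_succ_X_mul, sq, PowerSeries.coeff_mul]
    simp [geomSeries]

/-- The series whose coefficients are `m - ∑_k (a_{nk}^m - b_{nk}^m)`, the defects of the
differentiation formula on monomials. -/
def defectSeries (n : ℕ) : PowerSeries ℂ := PowerSeries.mk fun m =>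
  (m : ℂ) - ((besselZeros n).map fun α => nodeA α ^ m - nodeB α ^ m).sum

theorem defectSeries_eq_sub (n : ℕ) : defectSeries n =
    (PowerSeries.mk fun m => (m : ℂ)) -
      ((besselZeros n).map fun α => geomSeries (nodeA α) - geomSeries (nodeB α)).sum := by
  ext m
  rw [map_sub, map_multiset_sum, Multiset.map_map]
  simp [defectSeries, geomSeries]

open PowerSeries in
/-- Closed form of the defect series. -/
theorem defectSeries_eq (n : ℕ) : defectSeries n =
    C ((-1) ^ n * ((n ! : ℂ) / ((2 * n)! : ℂ)) ^ 2) * X ^ (2 * n + 1) * geomSeries 1 ^ 2 *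
      ((besselZeros n).map fun α => geomSeries (nodeA α) * geomSeries (nodeB α)).prod := by
  -- The point `v` has a pole at `X = 0`, so the computation takes place in the fraction field.
  obtain ⟨K, _, ι, hι⟩ : ∃ (K : Type) (_ : Field K) (ι : ℂ⟦X⟧ →+* K), Function.Injective ι :=
    ⟨FractionRing ℂ⟦X⟧, inferInstance, algebraMap _ _, IsFractionRing.injective _ _⟩
  apply hι
  let κ : ℂ →+* K := ι.comp C
  have hκ (c : ℂ) : ι (C c) = κ c := rfl
  set x : K := ι X with hx
  have hx0 : x ≠ 0 := by
    rw [hx, Ne, map_eq_zero_iff ι hι]; exact X_ne_zero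
  have hgeom (a : ℂ) : ι (geomSeries a) * (1 - κ a * x) = 1 := by
    have := congrArg ι (geomSeries_mul a)
    simpa [hκ] using this
  have hne (a : ℂ) : 1 - κ a * x ≠ 0 := right_ne_zero_of_mul_eq_one (hgeom a)
  have hinv (a : ℂ) : ι (geomSeries a) = (1 - κ a * x)⁻¹ := eq_inv_of_mul_eq_one_left (hgeom a)
  have hone : ι (geomSeries 1) = (1 - x)⁻¹ := by simpa using hinv 1
  have hx1 : 1 - x ≠ 0 := by simpa using hne 1
  obtain ⟨v, hv⟩ : ∃ v : K, v = 2 * (1 - x) / x := ⟨_, rfl⟩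
  have h2 : (2 : K) ≠ 0 := by
    rw [← map_ofNat κ 2, map_ne_zero]
    norm_num
  have hA (α : ℂ) : -v - κ α = -(2 / x) * (1 - κ (nodeA α) * x) := by
    simp only [nodeA, map_sub, map_div₀, map_one, map_ofNat, hv]
    field_simp
    ring
  have hB (α : ℂ) : v - κ α = 2 / x * (1 - κ (nodeB α) * x) := by
    simp only [nodeB, map_add, map_div₀, map_one, map_ofNat, hv]
    field_simp
    ring
  set y := (besselPoly n).map κ with hy
  have hsplit : y.Splits := (IsAlgClosed.splits (besselPoly n)).map κ
  have hroots : y.roots = (besselZeros n).map κ := (IsAlgClosed.splits (besselPoly n)).roots_map κ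
  have heval (w : K) : y.eval w =
      κ ((besselPoly n).leadingCoeff) * ((besselZeros n).map fun α => w - κ α).prod := by
    rw [hsplit.eval_eq_prod_roots, hroots, Multiset.map_map, hy, Polynomial.leadingCoeff_map]
    rfl
  have hlead : κ ((besselPoly n).leadingCoeff) ≠ 0 := by
    rw [map_ne_zero, Polynomial.leadingCoeff_ne_zero]
    exact besselPoly_ne_zero n
  have hyv : y.eval v ≠ 0 := by
    rw [heval]
    refine mul_ne_zero hlead (Multiset.prod_ne_zero ?_)
    simp only [Multiset.mem_map, not_exists, not_and]
    intro α _
    rw [hB]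
    exact mul_ne_zero (div_ne_zero h2 hx0) (hne _)
  have hyv' : y.eval (-v) ≠ 0 := by
    rw [heval]
    refine mul_ne_zero hlead (Multiset.prod_ne_zero ?_)
    simp only [Multiset.mem_map, not_exists, not_and]
    intro α _
    rw [hA]
    exact mul_ne_zero (neg_ne_zero.2 (div_ne_zero h2 hx0)) (hne _)
  have hsum : ((besselZeros n).map fun α =>
      ι (geomSeries (nodeA α)) - ι (geomSeries (nodeB α))).sum =
      -(2 / x) * (y.derivative.eval (-v) / y.eval (-v) + y.derivative.eval v / y.eval v) := by
    rw [hsplit.eval_derivative_div_eval_of_ne_zero hyv,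
      hsplit.eval_derivative_div_eval_of_ne_zero hyv', hroots, Multiset.map_map, Multiset.map_map,
      ← Multiset.sum_map_add, ← Multiset.sum_map_mul_left]
    refine congrArg _ (Multiset.map_congr rfl fun α _ => ?_)
    simp only [Function.comp_apply, hA, hB, hinv]
    have := hne (nodeA α)
    have := hne (nodeB α)
    field_simp
    ring
  have hprod : y.eval v * y.eval (-v) * ((besselZeros n).map fun α =>
      ι (geomSeries (nodeA α)) * ι (geomSeries (nodeB α))).prod =
      κ ((besselPoly n).leadingCoeff) ^ 2 * (-4 / x ^ 2) ^ n := by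
    have : ((besselZeros n).map fun α => v - κ α).prod * ((besselZeros n).map fun α => -v - κ α).prod
        * ((besselZeros n).map fun α =>
          ι (geomSeries (nodeA α)) * ι (geomSeries (nodeB α))).prod = (-4 / x ^ 2) ^ n := by
      rw [← Multiset.prod_map_mul, ← Multiset.prod_map_mul]
      trans ((besselZeros n).map fun _ => -4 / x ^ 2).prod
      · refine congrArg _ (Multiset.map_congr rfl fun α _ => ?_)
        simp only [hA, hB, hinv]
        have hA' := hne (nodeA α)
        have hB' := hne (nodeB α)
        generalize 1 - κ (nodeA α) * x = A at hA' ⊢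
        generalize 1 - κ (nodeB α) * x = B at hB' ⊢
        field_simp
        norm_num
      · rw [Multiset.map_const', Multiset.prod_replicate, card_besselZeros]
    rw [heval, heval, ← this]
    ring
  have hW : y.eval v * y.eval (-v) + 1 / 2 * v ^ 2 *
      (y.derivative.eval v * y.eval (-v) + y.eval v * y.derivative.eval (-v)) = 1 := by
    have := congrArg (fun p => (p.map κ).eval v) (besselPoly_wronskian n)
    simpa only [Polynomial.map_add, Polynomial.map_mul, Polynomial.map_comp, Polynomial.map_neg,
      Polynomial.map_X, Polynomial.map_C, Polynomial.map_pow, Polynomial.map_one,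
      ← Polynomial.derivative_map, ← hy, Polynomial.eval_add, Polynomial.eval_mul,
      Polynomial.eval_comp, Polynomial.eval_neg, Polynomial.eval_X, Polynomial.eval_C,
      Polynomial.eval_pow, Polynomial.eval_one, map_div₀, map_one, map_ofNat] using this
  have hconst : κ ((-1) ^ n * ((n ! : ℂ) / ((2 * n)! : ℂ)) ^ 2) *
      (κ ((besselPoly n).leadingCoeff) ^ 2 * (-4) ^ n) = 1 := by
    have : ((-1) ^ n * ((n ! : ℂ) / ((2 * n)! : ℂ)) ^ 2) *
        ((besselPoly n).leadingCoeff ^ 2 * (-4) ^ n) = 1 := by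
      have h1 : (n ! : ℂ) ≠ 0 := by exact_mod_cast n.factorial_ne_zero
      have h2 : ((2 * n)! : ℂ) ≠ 0 := by exact_mod_cast (2 * n).factorial_ne_zero
      rw [besselPoly_leadingCoeff]
      field_simp
      rw [← pow_mul, mul_comm n 2, pow_mul, ← mul_pow, ← mul_pow]
      norm_num
    have := congrArg κ this
    simpa only [map_mul, map_pow, map_neg, map_one, map_ofNat] using this
  set P := ((besselZeros n).map fun α =>
    ι (geomSeries (nodeA α)) * ι (geomSeries (nodeB α))).prod with hP
  set d := κ ((-1) ^ n * ((n ! : ℂ) / ((2 * n)! : ℂ)) ^ 2) with hd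
  set S := y.derivative.eval (-v) / y.eval (-v) + y.derivative.eval v / y.eval v with hS
  have hP' : y.eval v * y.eval (-v) * (d * x ^ (2 * n) * P) = 1 := by
    calc _ = d * x ^ (2 * n) * (y.eval v * y.eval (-v) * P) := by ring
      _ = d * (κ ((besselPoly n).leadingCoeff) ^ 2 * (-4) ^ n) := by
        rw [hprod, div_pow, ← pow_mul]
        field_simp
      _ = 1 := hconst
  -- The Wronskian identity divided by `y(v) y(-v)`.
  have hE : d * x ^ (2 * n) * P = 1 + 1 / 2 * v ^ 2 * S := by
    rw [eq_inv_of_mul_eq_one_right hP', hS]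
    field_simp at hW ⊢
    linear_combination -hW
  have hL : ι (defectSeries n) = x * (1 - x)⁻¹ ^ 2 - -(2 / x) * S := by
    rw [defectSeries_eq_sub, mk_natCast_eq, map_sub, map_multiset_sum, Multiset.map_map, ← hsum,
      map_mul, map_pow, hone]
    simp only [Function.comp_def, map_sub, hx]
  have hR : ι (C ((-1) ^ n * ((n ! : ℂ) / ((2 * n)! : ℂ)) ^ 2) * X ^ (2 * n + 1) *
      geomSeries 1 ^ 2 * ((besselZeros n).map fun α =>
        geomSeries (nodeA α) * geomSeries (nodeB α)).prod) =
      x * (1 - x)⁻¹ ^ 2 * (d * x ^ (2 * n) * P) := by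
    rw [map_mul, map_mul, map_mul, hκ, map_pow, map_pow, hone, map_multiset_prod,
      Multiset.map_map, ← hd, ← hx]
    simp only [Function.comp_def, map_mul, ← hP]
    ring
  rw [hL, hR, hE, hv]
  field_simp
  ring

/-! ### A submultiplicative norm on power series, with values in `[0, ∞]` to avoid summability
conditions. -/

/-- The weighted `ℓ¹`-norm `∑ |F_m| x^m` of a power series. -/
def weightedNorm (x : ℝ≥0∞) (F : PowerSeries ℂ) : ℝ≥0∞ :=
  ∑' m, ‖PowerSeries.coeff m F‖ₑ * x ^ m

theorem weightedNorm_add_le (x : ℝ≥0∞) (F G : PowerSeries ℂ) :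
    weightedNorm x (F + G) ≤ weightedNorm x F + weightedNorm x G := by
  rw [weightedNorm, weightedNorm, weightedNorm, ← ENNReal.tsum_add]
  refine ENNReal.tsum_le_tsum fun m => ?_
  rw [← add_mul, map_add]
  gcongr
  exact enorm_add_le _ _

theorem weightedNorm_mul_le (x : ℝ≥0∞) (F G : PowerSeries ℂ) :
    weightedNorm x (F * G) ≤ weightedNorm x F * weightedNorm x G := by
  have h : weightedNorm x F * weightedNorm x G = ∑' m, ∑ p ∈ Finset.HasAntidiagonal.antidiagonal m,
      (‖PowerSeries.coeff p.1 F‖ₑ * x ^ p.1) * (‖PowerSeries.coeff p.2 G‖ₑ * x ^ p.2) := by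
    rw [weightedNorm, weightedNorm, ← ENNReal.tsum_mul_right]
    simp_rw [← ENNReal.tsum_mul_left]
    rw [← ENNReal.tsum_prod (f := fun i j => (‖PowerSeries.coeff i F‖ₑ * x ^ i) *
        (‖PowerSeries.coeff j G‖ₑ * x ^ j)),
      ← Finset.HasAntidiagonal.sigmaAntidiagonalEquivProd.tsum_eq, ENNReal.tsum_sigma']
    refine tsum_congr fun m => ?_
    rw [tsum_fintype, ← Finset.sum_coe_sort (Finset.HasAntidiagonal.antidiagonal m)]
    rfl
  rw [h, weightedNorm]
  refine ENNReal.tsum_le_tsum fun m => ?_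
  rw [PowerSeries.coeff_mul]
  refine (mul_le_mul_left (enorm_sum_le _ _) _).trans ?_
  rw [Finset.sum_mul]
  refine Finset.sum_le_sum fun p hp => ?_
  rw [← Finset.HasAntidiagonal.mem_antidiagonal.1 hp, enorm_mul, pow_add]
  exact (mul_mul_mul_comm _ _ _ _).le

theorem weightedNorm_one (x : ℝ≥0∞) : weightedNorm x 1 = 1 := by
  rw [weightedNorm, tsum_eq_single 0]
  · simp
  · intro m hm; simp [PowerSeries.coeff_one, hm]

theorem weightedNorm_C_mul_X_pow (x : ℝ≥0∞) (c : ℂ) (k : ℕ) :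
    weightedNorm x (PowerSeries.C c * PowerSeries.X ^ k) = ‖c‖ₑ * x ^ k := by
  rw [weightedNorm, tsum_eq_single k]
  · simp
  · intro m hm; simp [PowerSeries.coeff_X_pow, hm]

theorem weightedNorm_geomSeries (x : ℝ≥0∞) (a : ℂ) :
    weightedNorm x (geomSeries a) = (1 - ‖a‖ₑ * x)⁻¹ := by
  rw [← ENNReal.tsum_geometric]
  simp [weightedNorm, geomSeries, mul_pow]

theorem weightedNorm_prod_le (x B : ℝ≥0∞) (s : Multiset (PowerSeries ℂ))
    (h : ∀ F ∈ s, weightedNorm x F ≤ B) : weightedNorm x s.prod ≤ B ^ s.card := by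
  induction s using Multiset.induction_on with
  | empty => simp [weightedNorm_one]
  | cons F s ih =>
    rw [Multiset.prod_cons, Multiset.card_cons, pow_succ']
    refine (weightedNorm_mul_le _ _ _).trans ?_
    gcongr
    · exact h F (Multiset.mem_cons_self F s)
    · exact ih fun G hG => h G (Multiset.mem_cons_of_mem hG)

/-! ### Norm estimates for the node factors and the defect series. -/

-- The nodes are symmetric about `1`, so the terms linear in `α` cancel. The fixed-point form lets
-- the norm of the product be bounded in terms of itself.
open PowerSeries in
theorem geomSeries_nodes_mul (α : ℂ) :
    geomSeries (nodeA α) * geomSeries (nodeB α) = geomSeries 1 ^ 2 +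
      C ((α / 2) ^ 2) * X ^ 2 * (geomSeries 1 ^ 2 *
        (geomSeries (nodeA α) * geomSeries (nodeB α))) := by
  have h1 := geomSeries_one_mul
  have ha := geomSeries_mul (nodeA α)
  have hb := geomSeries_mul (nodeB α)
  simp only [nodeA, nodeB, map_add, map_sub, map_one, map_pow] at *
  set c : ℂ⟦X⟧ := C (α / 2)
  set A := geomSeries (1 - α / 2)
  set B := geomSeries (1 + α / 2)
  set J := geomSeries (1 : ℂ)
  have hab : A * B * ((1 - X) ^ 2 - c ^ 2 * X ^ 2) = 1 := by
    linear_combination (B * (1 - (1 + c) * X)) * ha + hb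
  have hJ : J ^ 2 * (1 - X) ^ 2 = 1 := by
    linear_combination (J * (1 - X) + 1) * h1
  linear_combination J ^ 2 * hab - A * B * hJ

theorem weightedNorm_geomSeries_one_sq_le {x : ℝ} (hx : x ∈ Set.Ioo (0 : ℝ) 1) :
    weightedNorm (ENNReal.ofReal x) (geomSeries 1 ^ 2) ≤ ENNReal.ofReal ((1 - x)⁻¹ ^ 2) := by
  have h1x : 0 < 1 - x := by linarith [hx.2]
  have hJ : weightedNorm (ENNReal.ofReal x) (geomSeries 1) = ENNReal.ofReal (1 - x)⁻¹ := by
    rw [weightedNorm_geomSeries, ENNReal.ofReal_inv_of_pos h1x, ENNReal.ofReal_sub _ hx.1.le]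
    simp
  rw [sq, ENNReal.ofReal_pow (inv_nonneg.2 h1x.le), sq, ← hJ]
  exact weightedNorm_mul_le _ _ _

/-- The key estimate for one pair of nodes; `ρ` bounds `|α / 2|`. -/
theorem weightedNorm_nodes_le {x ρ θ : ℝ} (hx : x ∈ Set.Ioo (0 : ℝ) 1) {α : ℂ}
    (hα : ‖α‖ / 2 ≤ ρ) (hA : ‖nodeA α‖ * x < 1) (hB : ‖nodeB α‖ * x < 1)
    (hθ : ρ ^ 2 * x ^ 2 ≤ θ * (1 - x) ^ 2) (hθ1 : θ < 1) :
    weightedNorm (ENNReal.ofReal x) (geomSeries (nodeA α) * geomSeries (nodeB α)) ≤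
      ENNReal.ofReal (1 / ((1 - x) ^ 2 * (1 - θ))) := by
  have hx0 := hx.1
  have hx1 := hx.2
  set X := ENNReal.ofReal x
  set L := geomSeries (nodeA α) * geomSeries (nodeB α) with hL
  -- Finiteness is what permits moving `θ * l` to the left side of `l ≤ (1-x)⁻² + θ * l`.
  have hfin : weightedNorm X L ≠ ⊤ := by
    refine ne_top_of_le_ne_top (ENNReal.mul_ne_top ?_ ?_) (weightedNorm_mul_le _ _ _)
    all_goals
      rw [weightedNorm_geomSeries, ENNReal.inv_ne_top, ← ofReal_norm,
        ← ENNReal.ofReal_mul (norm_nonneg _), ← ENNReal.ofReal_one,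
        ← ENNReal.ofReal_sub _ (by positivity)]
      rw [Ne, ENNReal.ofReal_eq_zero, not_le]
      linarith
  have hJ2 := weightedNorm_geomSeries_one_sq_le hx
  have hineq : weightedNorm X L ≤ ENNReal.ofReal ((1 - x)⁻¹ ^ 2) +
      ENNReal.ofReal (‖(α / 2) ^ 2‖ * x ^ 2) *
        (ENNReal.ofReal ((1 - x)⁻¹ ^ 2) * weightedNorm X L) := by
    conv_lhs => rw [hL, geomSeries_nodes_mul, ← hL]
    refine (weightedNorm_add_le _ _ _).trans (add_le_add hJ2 ?_)
    refine (weightedNorm_mul_le _ _ _).trans (mul_le_mul' ?_ ?_)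
    · rw [weightedNorm_C_mul_X_pow, ENNReal.ofReal_mul (norm_nonneg _), ofReal_norm,
        ENNReal.ofReal_pow hx0.le]
    · exact (weightedNorm_mul_le _ _ _).trans (mul_le_mul' hJ2 le_rfl)
  obtain ⟨l, hl0, hl⟩ : ∃ l : ℝ, 0 ≤ l ∧ weightedNorm X L = ENNReal.ofReal l :=
    ⟨_, ENNReal.toReal_nonneg, (ENNReal.ofReal_toReal hfin).symm⟩
  have h1x : 0 < 1 - x := by linarith
  rw [hl, ← ENNReal.ofReal_mul (by positivity), ← ENNReal.ofReal_mul (by positivity),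
    ← ENNReal.ofReal_add (by positivity) (by positivity),
    ENNReal.ofReal_le_ofReal_iff (by positivity)] at hineq
  rw [hl]
  refine ENNReal.ofReal_le_ofReal ?_
  have hn : ‖(α / 2) ^ 2‖ * x ^ 2 ≤ θ * (1 - x) ^ 2 := by
    refine le_trans ?_ hθ
    rw [norm_pow, norm_div, Complex.norm_ofNat]
    gcongr
  have h2 : ‖(α / 2) ^ 2‖ * x ^ 2 * ((1 - x)⁻¹ ^ 2 * l) ≤ θ * l := by
    calc _ ≤ θ * (1 - x) ^ 2 * ((1 - x)⁻¹ ^ 2 * l) := by gcongr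
      _ = θ * l := by field_simp
  rw [le_div_iff₀ (mul_pos (by positivity) (by linarith))]
  have h3 : l * (1 - θ) ≤ (1 - x)⁻¹ ^ 2 := by linarith
  calc l * ((1 - x) ^ 2 * (1 - θ)) = (1 - x) ^ 2 * (l * (1 - θ)) := by ring
    _ ≤ (1 - x) ^ 2 * (1 - x)⁻¹ ^ 2 := by gcongr
    _ = 1 := by field_simp

theorem norm_half_le_of_mem_besselZeros {n : ℕ} {α : ℂ} (hα : α ∈ besselZeros n) :
    ‖α‖ / 2 ≤ 1 / (n + 1) := by
  have := norm_le_of_mem_besselZeros hα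
  rw [div_le_iff₀ two_pos]
  calc ‖α‖ ≤ 2 / (n + 1) := this
    _ = 1 / (n + 1) * 2 := by ring

theorem norm_node_mul_lt_one {n : ℕ} (hn : 1 ≤ n) {x : ℝ} (hx : x ∈ Set.Ioo (0 : ℝ) 1)
    (hxn : x ^ 2 ≤ (n + 1) * (1 - x) ^ 2) {α : ℂ} (hα : α ∈ besselZeros n) :
    ‖nodeA α‖ * x < 1 ∧ ‖nodeB α‖ * x < 1 := by
  obtain ⟨hx0, hx1⟩ := hx
  have hn' : (1 : ℝ) ≤ n := by exact_mod_cast hn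
  have h1x : 0 < 1 - x := by linarith
  have hα' := norm_half_le_of_mem_besselZeros hα
  have hnorm : ‖α / 2‖ = ‖α‖ / 2 := by rw [norm_div, Complex.norm_ofNat]
  -- Otherwise `x² ≥ (n+1)² (1-x)²`, which exceeds `(n+1) (1-x)²` as `n ≥ 1`.
  have hlt : x < (n + 1) * (1 - x) := by
    by_contra! h
    have h3 : ((n + 1) * (1 - x)) ^ 2 ≤ x ^ 2 := by gcongr
    have h4 : 0 < (n + 1) * n * (1 - x) ^ 2 := by positivity
    nlinarith
  have key : (1 + 1 / (n + 1 : ℝ)) * x < 1 := by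
    have : 1 / (n + 1 : ℝ) * x < 1 - x := by
      rw [one_div_mul_eq_div, div_lt_iff₀ (by positivity)]
      linarith
    linarith
  have hA : ‖nodeA α‖ ≤ 1 + 1 / (n + 1 : ℝ) := by
    refine (norm_sub_le _ _).trans ?_
    rw [norm_one, hnorm]
    gcongr
  have hB : ‖nodeB α‖ ≤ 1 + 1 / (n + 1 : ℝ) := by
    refine (norm_add_le _ _).trans ?_
    rw [norm_one, hnorm]
    gcongr
  exact ⟨(mul_le_mul_of_nonneg_right hA hx0.le).trans_lt key,
    (mul_le_mul_of_nonneg_right hB hx0.le).trans_lt key⟩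

theorem weightedNorm_defectSeries_le {n : ℕ} (hn : 1 ≤ n) {x : ℝ} (hx : x ∈ Set.Ioo (0 : ℝ) 1)
    (hxn : x ^ 2 ≤ (n + 1) * (1 - x) ^ 2) :
    weightedNorm (ENNReal.ofReal x) (defectSeries n) ≤
      ENNReal.ofReal (Real.exp 1 * (x ^ (2 * n + 1) / (1 - x) ^ (2 * n + 2)) *
        ((n ! : ℝ) ^ 2 / ((2 * n)! : ℝ) ^ 2)) := by
  have hx0 := hx.1
  have h1x : 0 < 1 - x := by linarith [hx.2]
  have hn' : (0 : ℝ) < n := by exact_mod_cast hn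
  have hprod : weightedNorm (ENNReal.ofReal x) ((besselZeros n).map fun α =>
      geomSeries (nodeA α) * geomSeries (nodeB α)).prod ≤
      ENNReal.ofReal ((1 / ((1 - x) ^ 2 * (1 - 1 / (n + 1 : ℝ)))) ^ n) := by
    refine (weightedNorm_prod_le _
      (ENNReal.ofReal (1 / ((1 - x) ^ 2 * (1 - 1 / (n + 1 : ℝ))))) _ ?_).trans ?_
    · intro F hF
      obtain ⟨α, hα, rfl⟩ := Multiset.mem_map.1 hF
      obtain ⟨hA, hB⟩ := norm_node_mul_lt_one hn hx hxn hα
      -- Here `ρ = θ = 1/(n+1)`, so that `1/(1-θ) = 1 + 1/n`.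
      refine weightedNorm_nodes_le hx (norm_half_le_of_mem_besselZeros hα) hA hB ?_ ?_
      · rw [div_pow, one_pow, one_div_mul_eq_div, one_div_mul_eq_div,
          div_le_div_iff₀ (by positivity) (by positivity)]
        calc x ^ 2 * (n + 1) ≤ (n + 1) * (1 - x) ^ 2 * (n + 1) := by gcongr
          _ = (1 - x) ^ 2 * (n + 1) ^ 2 := by ring
      · rw [div_lt_one (by positivity)]
        linarith
    · rw [Multiset.card_map, card_besselZeros, ENNReal.ofReal_pow]
      have : (1 : ℝ) - 1 / (n + 1) = n / (n + 1) := by field_simp; ring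
      rw [this]
      positivity
  have hJ : weightedNorm (ENNReal.ofReal x) (geomSeries 1 ^ 2) ≤
      ENNReal.ofReal ((1 - x)⁻¹ ^ 2) := weightedNorm_geomSeries_one_sq_le hx
  have hc : ‖(-1 : ℂ) ^ n * ((n ! : ℂ) / ((2 * n)! : ℂ)) ^ 2‖ₑ =
      ENNReal.ofReal ((n ! : ℝ) ^ 2 / ((2 * n)! : ℝ) ^ 2) := by
    rw [← ofReal_norm]
    simp [div_pow]
  rw [defectSeries_eq]
  refine (weightedNorm_mul_le _ _ _).trans ((mul_le_mul' ((weightedNorm_mul_le _ _ _).trans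
    (mul_le_mul' (weightedNorm_C_mul_X_pow _ _ _).le hJ)) hprod).trans ?_)
  rw [hc, ← ENNReal.ofReal_pow hx0.le, ← ENNReal.ofReal_mul (by positivity),
    ← ENNReal.ofReal_mul (by positivity), ← ENNReal.ofReal_mul (by positivity)]
  refine ENNReal.ofReal_le_ofReal ?_
  have h1 : 1 / ((1 - x) ^ 2 * (1 - 1 / (n + 1 : ℝ))) = (1 + (n : ℝ)⁻¹) * (1 - x)⁻¹ ^ 2 := by
    have h2 : (1 : ℝ) - 1 / (n + 1) = n / (n + 1) := by field_simp; ring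
    rw [h2]
    field_simp
  rw [h1, mul_pow]
  calc _ = (1 + (n : ℝ)⁻¹) ^ n * (x ^ (2 * n + 1) * (1 - x)⁻¹ ^ (2 * n + 2)) *
        ((n ! : ℝ) ^ 2 / ((2 * n)! : ℝ) ^ 2) := by ring
    _ ≤ Real.exp 1 * (x ^ (2 * n + 1) * (1 - x)⁻¹ ^ (2 * n + 2)) *
        ((n ! : ℝ) ^ 2 / ((2 * n)! : ℝ) ^ 2) := by
      gcongr
      exact Real.one_add_inv_pow_le_exp
    _ = _ := by rw [inv_pow, ← div_eq_mul_inv]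

theorem coeff_defectSeries_of_lt {n m : ℕ} (h : m < 2 * n + 1) :
    PowerSeries.coeff m (defectSeries n) = 0 := by
  rw [defectSeries_eq, mul_comm (PowerSeries.C _), mul_assoc, mul_assoc,
    PowerSeries.coeff_X_pow_mul', if_neg (by omega)]

/-! ### Taylor expansion of the remainder. -/

theorem hasSum_multiset_map_sum {ι : Type*} (s : Multiset ι) (g : ι → ℕ → ℂ) (F : ι → ℂ)
    (h : ∀ i ∈ s, HasSum (g i) (F i)) :
    HasSum (fun m => (s.map fun i => g i m).sum) (s.map F).sum := by
  induction s using Multiset.induction_on with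
  | empty => simp
  | cons i s ih =>
    simp only [Multiset.map_cons, Multiset.sum_cons]
    exact (h i (Multiset.mem_cons_self i s)).add
      (ih fun j hj => h j (Multiset.mem_cons_of_mem hj))

/-- The Taylor coefficients of `f` at `0`. -/
def taylorCoeff (f : ℂ → ℂ) (m : ℕ) : ℂ := (m ! : ℂ)⁻¹ * iteratedDeriv m f 0

theorem hasSum_taylorCoeff {f : ℂ → ℂ} (hf : AnalyticOnNhd ℂ f (Metric.ball 0 1)) {z : ℂ}
    (hz : z ∈ Metric.ball (0 : ℂ) 1) : HasSum (fun m => taylorCoeff f m * z ^ m) (f z) := by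
  have := Complex.hasSum_taylorSeries_on_ball hf.differentiableOn hz
  simp only [sub_zero, smul_eq_mul] at this
  refine this.congr_fun fun m => ?_
  rw [taylorCoeff]
  ring

theorem hasSum_mul_deriv {f : ℂ → ℂ} (hf : AnalyticOnNhd ℂ f (Metric.ball 0 1)) {z : ℂ}
    (hz : z ∈ Metric.ball (0 : ℂ) 1) :
    HasSum (fun m : ℕ => m * (taylorCoeff f m * z ^ m)) (z * deriv f z) := by
  rw [← hasSum_nat_add_iff' 1]
  simp only [Finset.sum_range_one, Nat.cast_zero, zero_mul, sub_zero]
  refine ((hasSum_taylorCoeff hf.deriv hz).mul_left z).congr_fun fun m => ?_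
  have : (m : ℂ) + 1 ≠ 0 := by exact_mod_cast m.succ_ne_zero
  rw [taylorCoeff, taylorCoeff, iteratedDeriv_succ', Nat.factorial_succ]
  push_cast
  field_simp
  ring

theorem hasSum_remainder {n : ℕ} {f : ℂ → ℂ} (hf : AnalyticOnNhd ℂ f (Metric.ball 0 1)) {z : ℂ}
    (hz : z ∈ Metric.ball (0 : ℂ) 1) (h : ∀ α ∈ besselZeros n,
      nodeA α * z ∈ Metric.ball (0 : ℂ) 1 ∧ nodeB α * z ∈ Metric.ball (0 : ℂ) 1) :
    HasSum (fun m => taylorCoeff f m * z ^ m * PowerSeries.coeff m (defectSeries n))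
      (remainder n f z) := by
  refine ((hasSum_mul_deriv hf hz).sub (hasSum_multiset_map_sum (besselZeros n) _ _ fun α hα =>
    (hasSum_taylorCoeff hf (h α hα).1).sub (hasSum_taylorCoeff hf (h α hα).2))).congr_fun
    fun m => ?_
  have : (fun α => taylorCoeff f m * (nodeA α * z) ^ m - taylorCoeff f m * (nodeB α * z) ^ m) =
      fun α => taylorCoeff f m * z ^ m * (nodeA α ^ m - nodeB α ^ m) := by
    ext α; ring
  rw [this, Multiset.sum_map_mul_left, defectSeries, PowerSeries.coeff_mk]
  ring

theorem exists_taylorCoeff_bound {f : ℂ → ℂ} (hf : AnalyticOnNhd ℂ f (Metric.ball 0 1)) {ρ : ℝ}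
    (hρ : ρ ∈ Set.Ico (0 : ℝ) 1) : ∃ M : ℝ, 0 ≤ M ∧ ∀ m, ‖taylorCoeff f m‖ * ρ ^ m ≤ M := by
  have hmem : (ρ : ℂ) ∈ Metric.ball (0 : ℂ) 1 := by
    simpa [abs_of_nonneg hρ.1] using hρ.2
  obtain ⟨M, hM⟩ := (hasSum_taylorCoeff hf hmem).summable.tendsto_atTop_zero.norm.bddAbove_range
  have hb (m : ℕ) : ‖taylorCoeff f m‖ * ρ ^ m ≤ M := by
    have := hM ⟨m, rfl⟩
    simpa [abs_of_nonneg hρ.1] using this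
  exact ⟨M, le_trans (by simp) (hb 0), hb⟩

end

/-! ### The error bound. -/

theorem theorem2 (f : ℂ → ℂ) (hf : AnalyticOnNhd ℂ f (Metric.ball 0 1))
    (ε : ℝ) (hε : ε ∈ Set.Ioo (0 : ℝ) 1) :
    ∃ C : ℝ, ∀ x ∈ Set.Ioo (0 : ℝ) 1, ∀ n : ℕ, nZero x ≤ (n : ℝ) →
      ∀ z : ℂ, ‖z‖ ≤ (1 - ε) * x →
        (∀ α ∈ besselZeros n,
          nodeA α * z ∈ Metric.ball (0 : ℂ) 1 ∧ nodeB α * z ∈ Metric.ball (0 : ℂ) 1) ∧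
        ‖remainder n f z‖ ≤
          C * ((1 - ε / 2) ^ (2 * n) * x ^ (2 * n + 1) / (1 - x) ^ (2 * n + 2)) *
            ((n ! : ℝ) ^ 2 / ((2 * n)! : ℝ) ^ 2) := by
  obtain ⟨hε0, hε1⟩ := hε
  have hq0 : 0 < 1 - ε / 2 := by linarith
  have hq1 : 1 - ε / 2 ≤ 1 := by linarith
  -- Splitting `1 - ε = ρ (1 - ε/2)`: the powers of `ρ` are absorbed by the Taylor coefficients,
  -- those of `1 - ε/2` remain as the gain.
  have hρ : (1 - ε) / (1 - ε / 2) ∈ Set.Ico (0 : ℝ) 1 :=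
    ⟨div_nonneg (by linarith) hq0.le, (div_lt_one hq0).2 (by linarith)⟩
  obtain ⟨M, hM0, hM⟩ := exists_taylorCoeff_bound hf hρ
  refine ⟨M * Real.exp 1, fun x hx n hn z hz => ?_⟩
  have hx0 := hx.1
  have hx1 : 0 < 1 - x := by linarith [hx.2]
  rw [nZero, sub_le_iff_le_add, max_le_iff] at hn
  have hn1 : 1 ≤ n := by
    have : (1 : ℝ) ≤ n := by linarith [hn.1]
    exact_mod_cast this
  have hxn : x ^ 2 ≤ (n + 1) * (1 - x) ^ 2 := (div_le_iff₀ (by positivity)).1 hn.2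
  have hzx : ‖z‖ ≤ x := hz.trans (by nlinarith)
  have hnodes : ∀ α ∈ besselZeros n,
      nodeA α * z ∈ Metric.ball (0 : ℂ) 1 ∧ nodeB α * z ∈ Metric.ball (0 : ℂ) 1 := by
    intro α hα
    obtain ⟨hA, hB⟩ := norm_node_mul_lt_one hn1 hx hxn hα
    simp only [mem_ball_zero_iff, norm_mul]
    exact ⟨(mul_le_mul_of_nonneg_left hzx (norm_nonneg _)).trans_lt hA,
      (mul_le_mul_of_nonneg_left hzx (norm_nonneg _)).trans_lt hB⟩
  refine ⟨hnodes, ?_⟩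
  have hsum := hasSum_remainder hf (mem_ball_zero_iff.2 (hzx.trans_lt hx.2)) hnodes
  have hterm (m : ℕ) : ‖taylorCoeff f m * z ^ m * PowerSeries.coeff m (defectSeries n)‖ₑ ≤
      ENNReal.ofReal (M * (1 - ε / 2) ^ (2 * n)) *
        (‖PowerSeries.coeff m (defectSeries n)‖ₑ * ENNReal.ofReal x ^ m) := by
    -- Only `m ≥ 2n+1` contributes, and there `(1 - ε/2)^m ≤ (1 - ε/2)^(2n)`.
    rcases lt_or_ge m (2 * n + 1) with h | h
    · simp [coeff_defectSeries_of_lt h]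
    · rw [enorm_mul, mul_comm, mul_left_comm, ← ENNReal.ofReal_pow hx0.le,
        ← ENNReal.ofReal_mul (by positivity), ← ofReal_norm (_ * _)]
      gcongr
      rw [norm_mul, norm_pow]
      calc ‖taylorCoeff f m‖ * ‖z‖ ^ m ≤ ‖taylorCoeff f m‖ * ((1 - ε) * x) ^ m := by gcongr
        _ = ‖taylorCoeff f m‖ * ((1 - ε) / (1 - ε / 2)) ^ m * ((1 - ε / 2) ^ m * x ^ m) := by
          rw [mul_assoc, ← mul_pow, ← mul_pow, ← mul_assoc, div_mul_cancel₀ _ hq0.ne']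
        _ ≤ M * ((1 - ε / 2) ^ (2 * n) * x ^ m) := by
          gcongr ?_ * (?_ * _)
          · exact hM m
          · exact pow_le_pow_of_le_one hq0.le hq1 (by omega)
        _ = _ := by ring
  have hmain : ‖remainder n f z‖ₑ ≤ ENNReal.ofReal (M * (1 - ε / 2) ^ (2 * n)) *
      weightedNorm (ENNReal.ofReal x) (defectSeries n) := by
    rw [← hsum.tsum_eq, weightedNorm, ← ENNReal.tsum_mul_left]
    exact enorm_tsum_le_tsum_enorm.trans (ENNReal.tsum_le_tsum hterm)
  have := hmain.trans (mul_le_mul_right (weightedNorm_defectSeries_le hn1 hx hxn) _)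
  rw [← ofReal_norm, ← ENNReal.ofReal_mul (by positivity),
    ENNReal.ofReal_le_ofReal_iff (by positivity)] at this
  refine this.trans (le_of_eq ?_)
  ring
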